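/- Let $M$ be a compact Hausdorff smooth $3$-manifold without boundary, and let $\omega$ be a smooth nowhere-vanishing $3$-form on $M$; give $M$ the orientation defined by $\omega$. Then there is a unique map $\{\cdot,\cdot,\cdot\}\colon C^\infty(M)\times C^\infty(M)\times C^\infty(M)\to C^\infty(M)$ (the Nambu bracket) such that $$df\wedge dg\wedge dh=\{f,g,h\}\,\omega\qquad\text{for all } f,g,h\in C^\infty(M).$$ It is $\mathbb{R}$-trilinear and alternating, and for all $f,g,h_1,h_2,h_3\in C^\infty(M)$ it satisfies 1. the Leibniz rule $\{f,g,h_1h_2\}=\{f,g,h_1\}h_2+h_1\{f,g,h_2\}$; 2. the fundamental identity $$\{f,g,\{h_1,h_2,h_3\}\}=\{\{f,g,h_1\},h_2,h_3\}+\{h_1,\{f,g,h_2\},h_3\}+\{h_1,h_2,\{f,g,h_3\}\}.$$ Moreover, $\langle f,g\rangle:=\int_M fg\,\omega$ is a symmetric, positive-definite (in particular nondegenerate) bilinear form on $C^\infty(M)$, and it satisfies the metricity identity $$\langle\{f,g,h_1\},h_2\rangle=-\langle\{f,g,h_2\},h_1\rangle\qquad\text{for all } f,g,h_1,h_2\in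 C^\infty(M).$$ Hence $C^\infty(M)$ with $\{\cdot,\cdot,\cdot\}$ and $\langle\cdot,\cdot\rangle$ is a metric $3$-Lie algebra, that is, a real vector space with an alternating trilinear bracket satisfying the fundamental identity and a symmetric nondegenerate bilinear form satisfying the metricity identity. -/

import Mathlib

open scoped Manifold ContDiff

noncomputable section

/-- The wedge product `α ∧ β ∧ γ` of three covectors on a real topological vector space:
`(α ∧ β ∧ γ)(v₀, v₁, v₂)` is the determinant of the matrix of values of `α, β, γ` on the `vⱼ`. -/
def wedgeThree {V : Type*} [AddCommGroup V] [Module ℝ V] [TopologicalSpace V]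
    (α β γ : V →L[ℝ] ℝ) : V [⋀^Fin 3]→L[ℝ] ℝ where
  toAlternatingMap := (Matrix.detRowAlternating (R := ℝ) (n := Fin 3)).compLinearMap
    (LinearMap.pi ![(α : V →ₗ[ℝ] ℝ), (β : V →ₗ[ℝ] ℝ), (γ : V →ₗ[ℝ] ℝ)])
  cont := by
    refine Continuous.matrix_det (A := fun v : Fin 3 → V => Matrix.of fun j i =>
      (![(α : V →ₗ[ℝ] ℝ), (β : V →ₗ[ℝ] ℝ), (γ : V →ₗ[ℝ] ℝ)] i) (v j)) ?_
    refine continuous_matrix fun j i => ?_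
    fin_cases i
    · exact α.continuous.comp (continuous_apply j)
    · exact β.continuous.comp (continuous_apply j)
    · exact γ.continuous.comp (continuous_apply j)

theorem wedgeThree_apply {V : Type*} [AddCommGroup V] [Module ℝ V] [TopologicalSpace V]
    (α β γ : V →L[ℝ] ℝ) (v : Fin 3 → V) :
    wedgeThree α β γ v =
      Matrix.det !![α (v 0), α (v 1), α (v 2);
                    β (v 0), β (v 1), β (v 2);
                    γ (v 0), γ (v 1), γ (v 2)] := by
  rw [← Matrix.det_transpose]
  refine congrArg Matrix.det (?_ : (Matrix.of fun j i =>
    (![(α : V →ₗ[ℝ] ℝ), (β : V →ₗ[ℝ] ℝ), (γ : V →ₗ[ℝ] ℝ)] i) (v j)) = _)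
  ext i j
  fin_cases i <;> fin_cases j <;> rfl

section Manifold

variable {M : Type*} [TopologicalSpace M] [ChartedSpace (EuclideanSpace ℝ (Fin 3)) M]

variable (M) in
/-- Differential `3`-forms on `M` (no regularity required). -/
abbrev ThreeForm : Type _ :=
  (x : M) → TangentSpace (𝓡 3) x [⋀^Fin 3]→L[ℝ] ℝ

/-- The expression of a `3`-form in the preferred chart `φ` at `c`, that is, its pullback
`(φ⁻¹)^* η`. It is meaningful on the target of the chart. -/
def ThreeForm.inChart (η : ThreeForm M) (c : M) (y : EuclideanSpace ℝ (Fin 3)) :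
    EuclideanSpace ℝ (Fin 3) [⋀^Fin 3]→L[ℝ] ℝ :=
  (η ((extChartAt (𝓡 3) c).symm y)).compContinuousLinearMap
    (mfderiv (𝓡 3) (𝓡 3) (extChartAt (𝓡 3) c).symm y)

/-- The coefficient `a` of a `3`-form `a dy₀ ∧ dy₁ ∧ dy₂` in the preferred chart at `c`. -/
def ThreeForm.coeff (η : ThreeForm M) (c : M) (y : EuclideanSpace ℝ (Fin 3)) : ℝ :=
  η.inChart c y fun i => EuclideanSpace.single i (1 : ℝ)

/-- A `3`-form is smooth if all its chart expressions are smooth. -/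
def ThreeForm.IsSmooth (η : ThreeForm M) : Prop :=
  ∀ c : M, ContDiffOn ℝ ∞ (η.inChart c) (extChartAt (𝓡 3) c).target

/-- A volume form: a smooth nowhere-vanishing `3`-form. It defines the orientation of `M` for
which it is positive. -/
structure ThreeForm.IsVolumeForm (Ω : ThreeForm M) : Prop where
  smooth : Ω.IsSmooth
  ne_zero : ∀ x, Ω x ≠ 0

/-- The orientation of the preferred chart at `c`, at the point with coordinates `y`, relative to
the orientation of `M` defined by the volume form `Ω`: it is `1` where the chart is positively
oriented and `-1` where it is negatively oriented. -/
def ThreeForm.chartSign (Ω : ThreeForm M) (c : M) (y : EuclideanSpace ℝ (Fin 3)) : ℝ :=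
  SignType.sign (Ω.coeff c y)

/-- A smooth partition of unity subordinate to the cover of `M` by the domains of its charts. -/
def chartPartition (M : Type*) [TopologicalSpace M]
    [ChartedSpace (EuclideanSpace ℝ (Fin 3)) M] [IsManifold (𝓡 3) ∞ M] [T2Space M]
    [CompactSpace M] : SmoothPartitionOfUnity M (𝓡 3) M Set.univ :=
  (SmoothPartitionOfUnity.exists_isSubordinate_chartAt_source (𝓡 3) M).choose

/-- The integral `∫_M η` of a `3`-form over the compact manifold `M` with the orientation defined
by the volume form `Ω`: with `ρ` a partition of unity subordinate to the chart domains, it is the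
sum over the charts `φ` of `± ∫ (φ⁻¹)^* (ρ η)`, the sign being that of the orientation of `φ`. -/
def ThreeForm.integral [IsManifold (𝓡 3) ∞ M] [T2Space M] [CompactSpace M]
    (Ω η : ThreeForm M) : ℝ :=
  ∑ᶠ c : M, ∫ y in (extChartAt (𝓡 3) c).target,
    Ω.chartSign c y *
      (chartPartition M c ((extChartAt (𝓡 3) c).symm y) * η.coeff c y)

/-- The pairing `⟨f, g⟩ = ∫_M f g Ω`, where `M` is oriented by `Ω`. -/
def ThreeForm.pairing [IsManifold (𝓡 3) ∞ M] [T2Space M] [CompactSpace M]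
    (Ω : ThreeForm M) (f g : C^∞⟮𝓡 3, M; ℝ⟯) : ℝ :=
  Ω.integral fun x => (f x * g x) • Ω x

/-- `br` is the Nambu bracket of `Ω`: `df ∧ dg ∧ dh = {f, g, h} Ω` for all smooth `f, g, h`. -/
def ThreeForm.IsNambuBracket (Ω : ThreeForm M)
    (br : C^∞⟮𝓡 3, M; ℝ⟯ → C^∞⟮𝓡 3, M; ℝ⟯ → C^∞⟮𝓡 3, M; ℝ⟯ → C^∞⟮𝓡 3, M; ℝ⟯) : Prop :=
  ∀ (f g h : C^∞⟮𝓡 3, M; ℝ⟯) (x : M),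
    wedgeThree (mvfderiv (𝓡 3) f x) (mvfderiv (𝓡 3) g x) (mvfderiv (𝓡 3) h x) =
      br f g h x • Ω x

end Manifold

/-- A real vector space with a bracket `V × V × V → V` and a pairing `V × V → ℝ` is a metric
3-Lie algebra if the bracket is trilinear and alternating, the pairing is a symmetric
nondegenerate bilinear form, and metricity and the fundamental identity hold. -/
structure IsMetricThreeLieAlgebra {V : Type*} [AddCommGroup V] [Module ℝ V]
    (br : V → V → V → V) (ip : V → V → ℝ) : Prop where
  alternating : ∃ T : V [⋀^Fin 3]→ₗ[ℝ] V, ∀ x y z, T ![x, y, z] = br x y z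
  bilinear : ∃ B : V →ₗ[ℝ] V →ₗ[ℝ] ℝ, ∀ x y, B x y = ip x y
  symmetric : ∀ x y, ip x y = ip y x
  nondegenerate : ∀ x, (∀ y, ip x y = 0) → x = 0
  metricity : ∀ x y z₁ z₂, ip (br x y z₁) z₂ = -ip (br x y z₂) z₁
  fundamental : ∀ x y z₁ z₂ z₃,
    br x y (br z₁ z₂ z₃) =
      br (br x y z₁) z₂ z₃ + br z₁ (br x y z₂) z₃ + br z₁ z₂ (br x y z₃)

end

/-! Alternating 3-forms on a 3-dimensional space form a line, so dividing `df ∧ dg ∧ dh` by the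
nonzero `Ω x` determines the bracket point by point. It is trilinear and alternating as a
determinant, and Leibniz because `d` is a derivation. In a chart with `Ω = a dy₀ ∧ dy₁ ∧ dy₂` it is
`a⁻¹` times a Jacobian determinant (`ThreeForm.nambuAt_extChartAt_symm`), hence smooth.

Behind the fundamental identity is the fact that the vector field `X = {f, g, ·}` preserves `Ω`,
since `ι_X Ω = df ∧ dg` is closed. The proof verifies it in a chart, by expanding derivatives
(`jacobianThree_fundamental`).

By Leibniz, metricity amounts to `∫ {f, g, h₁ h₂} Ω = 0`. A partition of unity reduces this to a
last argument `h` supported in one chart, where the integrand is, up to sign, a Jacobian, that is,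
the divergence of the compactly supported field `h (∇f × ∇g)`
(`ThreeForm.IsVolumeForm.chartIntegral_nambu`). The orientation sign turns the coefficient of `Ω`
into its absolute value, so integrals are independent of the chart by change of variables
(`ThreeForm.chartIntegral_eq`), and the pairing is positive definite. -/

open Set Function MeasureTheory

/-! ### Vector calculus of Jacobian determinants in three variables. -/

/-- The Jacobian determinant `∂(F, G, H) / ∂(y₀, y₁, y₂)`. -/
noncomputable def jacobianThree (F G H : EuclideanSpace ℝ (Fin 3) → ℝ)
    (y : EuclideanSpace ℝ (Fin 3)) : ℝ :=
  wedgeThree (fderiv ℝ F y) (fderiv ℝ G y) (fderiv ℝ H y)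
    fun i => EuclideanSpace.single i (1 : ℝ)

/-- The partial derivative `∂F / ∂yᵢ`. -/
noncomputable def partialDeriv (i : Fin 3) (F : EuclideanSpace ℝ (Fin 3) → ℝ)
    (y : EuclideanSpace ℝ (Fin 3)) : ℝ :=
  fderiv ℝ F y (EuclideanSpace.single i (1 : ℝ))

theorem jacobianThree_eq (F G H : EuclideanSpace ℝ (Fin 3) → ℝ)
    (y : EuclideanSpace ℝ (Fin 3)) :
    jacobianThree F G H y =
      partialDeriv 0 F y * partialDeriv 1 G y * partialDeriv 2 H y
      - partialDeriv 0 F y * partialDeriv 2 G y * partialDeriv 1 H y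
      - partialDeriv 1 F y * partialDeriv 0 G y * partialDeriv 2 H y
      + partialDeriv 1 F y * partialDeriv 2 G y * partialDeriv 0 H y
      + partialDeriv 2 F y * partialDeriv 0 G y * partialDeriv 1 H y
      - partialDeriv 2 F y * partialDeriv 1 G y * partialDeriv 0 H y := by
  rw [jacobianThree, wedgeThree_apply, Matrix.det_fin_three]
  rfl

theorem partialDeriv_congr {F G : EuclideanSpace ℝ (Fin 3) → ℝ} {y : EuclideanSpace ℝ (Fin 3)}
    (h : F =ᶠ[nhds y] G) (i : Fin 3) : partialDeriv i F y = partialDeriv i G y := by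
  rw [partialDeriv, partialDeriv, h.fderiv_eq]

theorem ContDiffAt.partialDeriv {F : EuclideanSpace ℝ (Fin 3) → ℝ}
    {y : EuclideanSpace ℝ (Fin 3)} (hF : ContDiffAt ℝ ∞ F y) (i : Fin 3) :
    ContDiffAt ℝ ∞ (partialDeriv i F) y :=
  (hF.fderiv_right (m := ∞) (by simp)).clm_apply contDiffAt_const

theorem partialDeriv_mul {F G : EuclideanSpace ℝ (Fin 3) → ℝ} {y : EuclideanSpace ℝ (Fin 3)}
    (hF : ContDiffAt ℝ ∞ F y) (hG : ContDiffAt ℝ ∞ G y) (i : Fin 3) :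
    partialDeriv i (fun z => F z * G z) y =
      partialDeriv i F y * G y + F y * partialDeriv i G y := by
  have := fderiv_fun_mul (hF.differentiableAt (by simp)) (hG.differentiableAt (by simp))
  simp only [partialDeriv, this]
  simp
  ring

theorem partialDeriv_add {F G : EuclideanSpace ℝ (Fin 3) → ℝ} {y : EuclideanSpace ℝ (Fin 3)}
    (hF : ContDiffAt ℝ ∞ F y) (hG : ContDiffAt ℝ ∞ G y) (i : Fin 3) :
    partialDeriv i (fun z => F z + G z) y = partialDeriv i F y + partialDeriv i G y := by
  have := fderiv_fun_add (hF.differentiableAt (by simp)) (hG.differentiableAt (by simp))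
  simp only [partialDeriv, this]
  simp

theorem partialDeriv_sub {F G : EuclideanSpace ℝ (Fin 3) → ℝ} {y : EuclideanSpace ℝ (Fin 3)}
    (hF : ContDiffAt ℝ ∞ F y) (hG : ContDiffAt ℝ ∞ G y) (i : Fin 3) :
    partialDeriv i (fun z => F z - G z) y = partialDeriv i F y - partialDeriv i G y := by
  have := fderiv_fun_sub (hF.differentiableAt (by simp)) (hG.differentiableAt (by simp))
  simp only [partialDeriv, this]
  simp

theorem partialDeriv_comm {F : EuclideanSpace ℝ (Fin 3) → ℝ} {y : EuclideanSpace ℝ (Fin 3)}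
    (hF : ContDiffAt ℝ ∞ F y) (i j : Fin 3) :
    partialDeriv i (partialDeriv j F) y = partialDeriv j (partialDeriv i F) y := by
  have hd : DifferentiableAt ℝ (fderiv ℝ F) y :=
    (hF.fderiv_right (m := ∞) (by simp)).differentiableAt (by simp)
  have key : ∀ k l : Fin 3, partialDeriv k (partialDeriv l F) y =
      fderiv ℝ (fderiv ℝ F) y (EuclideanSpace.single k 1) (EuclideanSpace.single l 1) := by
    intro k l
    have := fderiv_clm_apply hd
      (differentiableAt_const (c := (EuclideanSpace.single l (1 : ℝ) : EuclideanSpace ℝ (Fin 3))))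
    rw [partialDeriv]
    change fderiv ℝ (fun z => fderiv ℝ F z (EuclideanSpace.single l 1)) y _ = _
    rw [this]
    simp
  rw [key, key]
  exact (hF.isSymmSndFDerivAt (by simp; exact WithTop.coe_le_coe.2 (le_top (a := (2 : ℕ∞))))) _ _

theorem ContDiffAt.jacobianThree {F G H : EuclideanSpace ℝ (Fin 3) → ℝ}
    {y : EuclideanSpace ℝ (Fin 3)} (hF : ContDiffAt ℝ ∞ F y) (hG : ContDiffAt ℝ ∞ G y)
    (hH : ContDiffAt ℝ ∞ H y) : ContDiffAt ℝ ∞ (jacobianThree F G H) y := by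
  rw [funext (jacobianThree_eq F G H)]
  have f0 := hF.partialDeriv 0
  have f1 := hF.partialDeriv 1
  have f2 := hF.partialDeriv 2
  have g0 := hG.partialDeriv 0
  have g1 := hG.partialDeriv 1
  have g2 := hG.partialDeriv 2
  have h0 := hH.partialDeriv 0
  have h1 := hH.partialDeriv 1
  have h2 := hH.partialDeriv 2
  exact (((((f0.mul g1).mul h2).sub ((f0.mul g2).mul h1)).sub ((f1.mul g0).mul h2)).add
    ((f1.mul g2).mul h0)).add ((f2.mul g0).mul h1) |>.sub ((f2.mul g1).mul h0)

/-- A component of the cross product of the gradients of `F` and `G`. -/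
noncomputable def gradCross (i j : Fin 3) (F G : EuclideanSpace ℝ (Fin 3) → ℝ)
    (y : EuclideanSpace ℝ (Fin 3)) : ℝ :=
  partialDeriv i F y * partialDeriv j G y - partialDeriv j F y * partialDeriv i G y

theorem ContDiffAt.gradCross {F G : EuclideanSpace ℝ (Fin 3) → ℝ}
    {y : EuclideanSpace ℝ (Fin 3)} (hF : ContDiffAt ℝ ∞ F y) (hG : ContDiffAt ℝ ∞ G y)
    (i j : Fin 3) : ContDiffAt ℝ ∞ (gradCross i j F G) y :=
  ((hF.partialDeriv i).mul (hG.partialDeriv j)).sub ((hF.partialDeriv j).mul (hG.partialDeriv i))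

theorem partialDeriv_gradCross {F G : EuclideanSpace ℝ (Fin 3) → ℝ}
    {y : EuclideanSpace ℝ (Fin 3)} (hF : ContDiffAt ℝ ∞ F y) (hG : ContDiffAt ℝ ∞ G y)
    (i j k : Fin 3) : partialDeriv k (gradCross i j F G) y =
      partialDeriv k (partialDeriv i F) y * partialDeriv j G y
      + partialDeriv i F y * partialDeriv k (partialDeriv j G) y
      - (partialDeriv k (partialDeriv j F) y * partialDeriv i G y
      + partialDeriv j F y * partialDeriv k (partialDeriv i G) y) := by
  have := partialDeriv_sub ((hF.partialDeriv i).mul (hG.partialDeriv j))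
    ((hF.partialDeriv j).mul (hG.partialDeriv i)) k
  refine Eq.trans this ?_
  rw [← partialDeriv_mul (hF.partialDeriv i) (hG.partialDeriv j),
    ← partialDeriv_mul (hF.partialDeriv j) (hG.partialDeriv i)]

/-- The triple product `(∇F × ∇G) · ∇H`. Linearity in `∇H` is what makes its derivatives manageable.
-/
theorem jacobianThree_eq_gradCross (F G H : EuclideanSpace ℝ (Fin 3) → ℝ) :
    jacobianThree F G H = fun y => gradCross 1 2 F G y * partialDeriv 0 H y
      + gradCross 2 0 F G y * partialDeriv 1 H y + gradCross 0 1 F G y * partialDeriv 2 H y := by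
  funext y
  rw [jacobianThree_eq]
  simp only [gradCross]
  ring

theorem partialDeriv_jacobianThree {F G H : EuclideanSpace ℝ (Fin 3) → ℝ}
    {y : EuclideanSpace ℝ (Fin 3)} (hF : ContDiffAt ℝ ∞ F y) (hG : ContDiffAt ℝ ∞ G y)
    (hH : ContDiffAt ℝ ∞ H y) (k : Fin 3) : partialDeriv k (jacobianThree F G H) y =
      partialDeriv k (gradCross 1 2 F G) y * partialDeriv 0 H y
      + gradCross 1 2 F G y * partialDeriv k (partialDeriv 0 H) y
      + (partialDeriv k (gradCross 2 0 F G) y * partialDeriv 1 H y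
      + gradCross 2 0 F G y * partialDeriv k (partialDeriv 1 H) y)
      + (partialDeriv k (gradCross 0 1 F G) y * partialDeriv 2 H y
      + gradCross 0 1 F G y * partialDeriv k (partialDeriv 2 H) y) := by
  have a := hF.gradCross hG 1 2
  have b := hF.gradCross hG 2 0
  have c := hF.gradCross hG 0 1
  have h0 := hH.partialDeriv 0
  have h1 := hH.partialDeriv 1
  have h2 := hH.partialDeriv 2
  rw [jacobianThree_eq_gradCross, partialDeriv_add ((a.mul h0).add (b.mul h1)) (c.mul h2),
    partialDeriv_add (a.mul h0) (b.mul h1), partialDeriv_mul a h0, partialDeriv_mul b h1,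
    partialDeriv_mul c h2]

/-- The Jacobian determinant is a divergence. -/
theorem jacobianThree_eq_divergence {F G H : EuclideanSpace ℝ (Fin 3) → ℝ}
    {y : EuclideanSpace ℝ (Fin 3)} (hF : ContDiffAt ℝ ∞ F y) (hG : ContDiffAt ℝ ∞ G y)
    (hH : ContDiffAt ℝ ∞ H y) : jacobianThree F G H y =
      partialDeriv 0 (fun z => gradCross 1 2 F G z * H z) y
      + partialDeriv 1 (fun z => gradCross 2 0 F G z * H z) y
      + partialDeriv 2 (fun z => gradCross 0 1 F G z * H z) y := by
  -- The terms containing `H` undifferentiated add up to `H div (∇F × ∇G)`, which vanishes by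
  -- symmetry of second derivatives.
  rw [partialDeriv_mul (hF.gradCross hG 1 2) hH, partialDeriv_mul (hF.gradCross hG 2 0) hH,
    partialDeriv_mul (hF.gradCross hG 0 1) hH, partialDeriv_gradCross hF hG,
    partialDeriv_gradCross hF hG, partialDeriv_gradCross hF hG, jacobianThree_eq_gradCross,
    partialDeriv_comm hF 1 0, partialDeriv_comm hG 1 0, partialDeriv_comm hF 2 0,
    partialDeriv_comm hG 2 0, partialDeriv_comm hF 2 1, partialDeriv_comm hG 2 1]
  ring

/-- The bracket of `b⁻¹ dy₀ ∧ dy₁ ∧ dy₂` satisfies the fundamental identity. -/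
theorem jacobianThree_fundamental {F G H₁ H₂ H₃ b : EuclideanSpace ℝ (Fin 3) → ℝ}
    {y : EuclideanSpace ℝ (Fin 3)} (hF : ContDiffAt ℝ ∞ F y) (hG : ContDiffAt ℝ ∞ G y)
    (h₁ : ContDiffAt ℝ ∞ H₁ y) (h₂ : ContDiffAt ℝ ∞ H₂ y) (h₃ : ContDiffAt ℝ ∞ H₃ y)
    (hb : ContDiffAt ℝ ∞ b y) :
    jacobianThree F G (fun z => b z * jacobianThree H₁ H₂ H₃ z) y =
      jacobianThree (fun z => b z * jacobianThree F G H₁ z) H₂ H₃ y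
      + jacobianThree H₁ (fun z => b z * jacobianThree F G H₂ z) H₃ y
      + jacobianThree H₁ H₂ (fun z => b z * jacobianThree F G H₃ z) y := by
  rw [jacobianThree_eq F G (fun z => b z * jacobianThree H₁ H₂ H₃ z),
    jacobianThree_eq (fun z => b z * jacobianThree F G H₁ z) H₂ H₃,
    jacobianThree_eq H₁ (fun z => b z * jacobianThree F G H₂ z) H₃,
    jacobianThree_eq H₁ H₂ (fun z => b z * jacobianThree F G H₃ z)]
  simp only [partialDeriv_mul hb (h₁.jacobianThree h₂ h₃), partialDeriv_mul hb (hF.jacobianThree hG h₁),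
    partialDeriv_mul hb (hF.jacobianThree hG h₂), partialDeriv_mul hb (hF.jacobianThree hG h₃),
    partialDeriv_jacobianThree h₁ h₂ h₃, partialDeriv_jacobianThree hF hG h₁,
    partialDeriv_jacobianThree hF hG h₂, partialDeriv_jacobianThree hF hG h₃,
    partialDeriv_gradCross hF hG, partialDeriv_gradCross h₁ h₂]
  rw [jacobianThree_eq, jacobianThree_eq, jacobianThree_eq, jacobianThree_eq]
  -- With mixed partials in a fixed order, this is a polynomial identity. Derivatives of `b` cancel
  -- by Cramer's rule, which expresses `∇b` through the `∇Hᵢ`; second derivatives of `F` and `G`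
  -- cancel because `∇F × ∇G` is divergence free.
  simp only [gradCross,
    partialDeriv_comm hF 1 0, partialDeriv_comm hG 1 0, partialDeriv_comm hF 2 0,
    partialDeriv_comm hG 2 0, partialDeriv_comm hF 2 1, partialDeriv_comm hG 2 1,
    partialDeriv_comm h₁ 1 0, partialDeriv_comm h₂ 1 0, partialDeriv_comm h₃ 1 0,
    partialDeriv_comm h₁ 2 0, partialDeriv_comm h₂ 2 0, partialDeriv_comm h₃ 2 0,
    partialDeriv_comm h₁ 2 1, partialDeriv_comm h₂ 2 1, partialDeriv_comm h₃ 2 1]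
  ring

/-! ### Extension by zero and the divergence theorem for compact support. -/

theorem contDiff_indicator_of_eq_zero {U K : Set (EuclideanSpace ℝ (Fin 3))} (hU : IsOpen U)
    (hK : IsCompact K) (hKU : K ⊆ U) {W : EuclideanSpace ℝ (Fin 3) → ℝ}
    (hW : ∀ y ∈ U, ContDiffAt ℝ ∞ W y) (hW0 : ∀ y ∈ U, y ∉ K → W y = 0) :
    ContDiff ℝ ∞ (U.indicator W) := by
  rw [contDiff_iff_contDiffAt]
  intro y
  by_cases hy : y ∈ U
  · refine (hW y hy).congr_of_eventuallyEq ?_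
    filter_upwards [hU.mem_nhds hy] with z hz using indicator_of_mem hz _
  -- A point outside `U` has a neighbourhood missing the closed set `K`, and there the extension is
  -- identically zero.
  · refine (contDiffAt_const (c := (0 : ℝ))).congr_of_eventuallyEq ?_
    filter_upwards [hK.isClosed.isOpen_compl.mem_nhds fun h => hy (hKU h)] with z hz
    by_cases hzU : z ∈ U
    · rw [indicator_of_mem hzU, hW0 z hzU hz]
    · exact indicator_of_notMem hzU _

theorem integral_partialDeriv_eq_zero {W : EuclideanSpace ℝ (Fin 3) → ℝ} (hW : ContDiff ℝ ∞ W)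
    (hs : HasCompactSupport W) (i : Fin 3) : ∫ y, partialDeriv i W y = 0 := by
  have hc : Continuous (fun y => fderiv ℝ W y (EuclideanSpace.single i 1)) :=
    (hW.continuous_fderiv (by simp)).clm_apply continuous_const
  have hi : Integrable (fun y => fderiv ℝ W y (EuclideanSpace.single i 1)) :=
    hc.integrable_of_hasCompactSupport (hs.fderiv_apply ℝ _)
  -- Integration by parts against the constant function `1`.
  have := integral_mul_fderiv_eq_neg_fderiv_mul_of_integrable (μ := volume)
    (f := fun _ : EuclideanSpace ℝ (Fin 3) => (1 : ℝ)) (g := W)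
    (v := EuclideanSpace.single i 1) (by simp) (by simpa using hi)
    (by simpa using hW.continuous.integrable_of_hasCompactSupport hs)
    (fun x _ => differentiableAt_const _) (fun x _ => hW.differentiable (by simp) x)
  simpa [partialDeriv] using this

/-- Only `H` has to vanish off `K`: it is a factor of the field whose divergence is the Jacobian, so
that field extends by zero even though `F` and `G` may not. -/
theorem setIntegral_jacobianThree_eq_zero {U K : Set (EuclideanSpace ℝ (Fin 3))} (hU : IsOpen U)
    (hK : IsCompact K) (hKU : K ⊆ U) {F G H : EuclideanSpace ℝ (Fin 3) → ℝ}
    (hF : ∀ y ∈ U, ContDiffAt ℝ ∞ F y) (hG : ∀ y ∈ U, ContDiffAt ℝ ∞ G y)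
    (hH : ∀ y ∈ U, ContDiffAt ℝ ∞ H y) (hH0 : ∀ y ∈ U, y ∉ K → H y = 0) :
    ∫ y in U, jacobianThree F G H y = 0 := by
  set W : Fin 3 → Fin 3 → EuclideanSpace ℝ (Fin 3) → ℝ := fun i j =>
    U.indicator fun z => gradCross i j F G z * H z with hWdef
  have hW : ∀ i j, ContDiff ℝ ∞ (W i j) := fun i j =>
    contDiff_indicator_of_eq_zero hU hK hKU
      (fun y hy => ((hF y hy).gradCross (hG y hy) i j).mul (hH y hy))
      (fun y hy hyK => by rw [hH0 y hy hyK, mul_zero])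
  have hW0 : ∀ i j, ∀ y, y ∉ K → W i j y = 0 := fun i j y hy => by
    by_cases hyU : y ∈ U
    · simp only [hWdef, indicator_of_mem hyU, hH0 y hyU hy, mul_zero]
    · exact indicator_of_notMem hyU _
  have hs : ∀ i j, HasCompactSupport (W i j) := fun i j =>
    HasCompactSupport.intro hK (hW0 i j)
  have hint : ∀ i j k, Integrable (partialDeriv k (W i j)) := fun i j k =>
    (((hW i j).continuous_fderiv (by simp)).clm_apply
      continuous_const).integrable_of_hasCompactSupport ((hs i j).fderiv_apply ℝ _)
  have hp0 : ∀ i j k, ∀ y, y ∉ U → partialDeriv k (W i j) y = 0 := fun i j k y hy => by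
    have : W i j =ᶠ[nhds y] fun _ => 0 := by
      filter_upwards [hK.isClosed.isOpen_compl.mem_nhds fun h => hy (hKU h)] with z hz
      exact hW0 i j z hz
    rw [partialDeriv_congr this, partialDeriv]
    simp
  have hpU : ∀ i j k, ∀ y ∈ U, partialDeriv k (W i j) y =
      partialDeriv k (fun z => gradCross i j F G z * H z) y := fun i j k y hy =>
    partialDeriv_congr (by
      filter_upwards [hU.mem_nhds hy] with z hz using indicator_of_mem hz _) k
  calc ∫ y in U, jacobianThree F G H y
      = ∫ y in U, (partialDeriv 0 (W 1 2) y + partialDeriv 1 (W 2 0) y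
          + partialDeriv 2 (W 0 1) y) := by
        refine setIntegral_congr_fun hU.measurableSet fun y hy => ?_
        simp only [jacobianThree_eq_divergence (hF y hy) (hG y hy) (hH y hy), hpU _ _ _ y hy]
    _ = ∫ y, (partialDeriv 0 (W 1 2) y + partialDeriv 1 (W 2 0) y + partialDeriv 2 (W 0 1) y) :=
        setIntegral_eq_integral_of_forall_compl_eq_zero fun y hy => by
          simp only [hp0 _ _ _ y hy, add_zero]
    _ = 0 := by
        have h := integral_add (hint 1 2 0) (hint 2 0 1)
        have h' := integral_add ((hint 1 2 0).add (hint 2 0 1)) (hint 0 1 2)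
        simp only [Pi.add_apply] at h'
        rw [h', h, integral_partialDeriv_eq_zero (hW _ _) (hs _ _),
          integral_partialDeriv_eq_zero (hW _ _) (hs _ _),
          integral_partialDeriv_eq_zero (hW _ _) (hs _ _)]
        simp

/-! ### Top-degree forms and their pullbacks. -/

theorem eq_smul_of_apply_single {η θ : EuclideanSpace ℝ (Fin 3) [⋀^Fin 3]→L[ℝ] ℝ} {s : ℝ}
    (h : (θ fun i => EuclideanSpace.single i (1 : ℝ)) =
      s * η fun i => EuclideanSpace.single i (1 : ℝ)) : θ = s • η := by
  have hb : ⇑(EuclideanSpace.basisFun (Fin 3) ℝ).toBasis =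
      fun i => EuclideanSpace.single i (1 : ℝ) := by
    ext1 i
    simp
  apply ContinuousAlternatingMap.toAlternatingMap_injective
  rw [AlternatingMap.eq_smul_basis_det (EuclideanSpace.basisFun (Fin 3) ℝ).toBasis
      θ.toAlternatingMap,
    AlternatingMap.eq_smul_basis_det (EuclideanSpace.basisFun (Fin 3) ℝ).toBasis
      (s • η).toAlternatingMap]
  congr 1
  rw [hb]
  exact h

theorem compContinuousLinearMap_apply_single
    (η : EuclideanSpace ℝ (Fin 3) [⋀^Fin 3]→L[ℝ] ℝ)
    (L : EuclideanSpace ℝ (Fin 3) →L[ℝ] EuclideanSpace ℝ (Fin 3)) :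
    (η.compContinuousLinearMap L fun i => EuclideanSpace.single i (1 : ℝ)) =
      L.det * η fun i => EuclideanSpace.single i (1 : ℝ) := by
  have hb : ⇑(EuclideanSpace.basisFun (Fin 3) ℝ).toBasis =
      fun i => EuclideanSpace.single i (1 : ℝ) := by
    ext1 i
    simp
  have h := AlternatingMap.eq_smul_basis_det (EuclideanSpace.basisFun (Fin 3) ℝ).toBasis
      η.toAlternatingMap
  have h1 := (EuclideanSpace.basisFun (Fin 3) ℝ).toBasis.det_comp L.toLinearMap
    (EuclideanSpace.basisFun (Fin 3) ℝ).toBasis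
  have h2 := congrArg (fun ζ : EuclideanSpace ℝ (Fin 3) [⋀^Fin 3]→ₗ[ℝ] ℝ =>
    ζ (L ∘ fun i => EuclideanSpace.single i (1 : ℝ))) h
  rw [Module.Basis.det_self, mul_one, hb] at h1
  simp only [AlternatingMap.smul_apply, hb, smul_eq_mul] at h2
  refine Eq.trans h2 ?_
  rw [mul_comm]
  exact congrArg (· * _) h1

theorem wedgeThree_comp {V W : Type*} [AddCommGroup V] [Module ℝ V] [TopologicalSpace V]
    [AddCommGroup W] [Module ℝ W] [TopologicalSpace W] (α β γ : V →L[ℝ] ℝ) (L : W →L[ℝ] V) :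
    wedgeThree (α.comp L) (β.comp L) (γ.comp L) =
      (wedgeThree α β γ).compContinuousLinearMap L := by
  ext v
  exact (wedgeThree_apply _ _ _ v).trans (wedgeThree_apply α β γ (L ∘ v)).symm

/-! ### The bracket: pointwise construction, smoothness and algebraic identities. -/

section Manifold

variable {M : Type*} [TopologicalSpace M] [ChartedSpace (EuclideanSpace ℝ (Fin 3)) M]

/-- The value of a `3`-form on the standard basis of the tangent space at `x`. -/
noncomputable def ThreeForm.stdCoeff (η : ThreeForm M) (x : M) : ℝ :=
  η x fun i => (EuclideanSpace.single i (1 : ℝ) : EuclideanSpace ℝ (Fin 3))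

/-- The Jacobian determinant of the inverse of the preferred chart at `c`. -/
noncomputable def chartSymmDet (c : M) (y : EuclideanSpace ℝ (Fin 3)) : ℝ :=
  ContinuousLinearMap.det (M := EuclideanSpace ℝ (Fin 3))
    (mfderiv (𝓡 3) (𝓡 3) (extChartAt (𝓡 3) c).symm y)

theorem ThreeForm.coeff_eq (η : ThreeForm M) (c : M) (y : EuclideanSpace ℝ (Fin 3)) :
    η.coeff c y = chartSymmDet c y * η.stdCoeff ((extChartAt (𝓡 3) c).symm y) :=
  compContinuousLinearMap_apply_single (η ((extChartAt (𝓡 3) c).symm y)) _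

theorem ThreeForm.IsVolumeForm.stdCoeff_ne_zero {Ω : ThreeForm M} (hΩ : Ω.IsVolumeForm) (x : M) :
    Ω.stdCoeff x ≠ 0 := fun h => hΩ.ne_zero x <| by
  have := eq_smul_of_apply_single (η := 0) (θ := Ω x) (s := 0) (h.trans (zero_mul _).symm)
  exact this.trans (smul_zero _)

theorem ThreeForm.IsVolumeForm.smul_left_injective {Ω : ThreeForm M} (hΩ : Ω.IsVolumeForm) (x : M)
    {s t : ℝ} (h : s • Ω x = t • Ω x) : s = t := by
  have := DFunLike.congr_fun h
    (fun i => (EuclideanSpace.single i (1 : ℝ) : EuclideanSpace ℝ (Fin 3)))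
  exact mul_right_cancel₀ (hΩ.stdCoeff_ne_zero x) this

theorem ThreeForm.IsSmooth.contDiffAt_coeff {Ω : ThreeForm M} (hΩ : Ω.IsSmooth) {c : M}
    {y : EuclideanSpace ℝ (Fin 3)} (hy : y ∈ (extChartAt (𝓡 3) c).target) :
    ContDiffAt ℝ ∞ (Ω.coeff c) y := by
  have h := (hΩ c).contDiffAt ((isOpen_extChartAt_target c).mem_nhds hy)
  exact (ContinuousAlternatingMap.apply ℝ (EuclideanSpace ℝ (Fin 3)) ℝ (ι := Fin 3)
    (fun i => EuclideanSpace.single i (1 : ℝ))).contDiff.contDiffAt.comp y h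

/-- The differential of a smooth function at `x`, in the standard basis of the tangent space. -/
noncomputable def stdDifferential (x : M) : C^∞⟮𝓡 3, M; ℝ⟯ →ₗ[ℝ] (Fin 3 → ℝ) where
  toFun f i := mvfderiv (𝓡 3) f x (EuclideanSpace.single i (1 : ℝ) : EuclideanSpace ℝ (Fin 3))
  map_add' f g := by
    ext i
    have := mvfderiv_add (f.contMDiff.mdifferentiableAt (x := x) (by simp))
      (g.contMDiff.mdifferentiableAt (x := x) (by simp))
    exact DFunLike.congr_fun this _
  map_smul' r f := by
    ext i
    have := mvfderiv_smul (mdifferentiableAt_const (I := 𝓡 3) (x := x) (c := r))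
      (f.contMDiff.mdifferentiableAt (x := x) (by simp))
    rw [mvfderiv_const, (by ext; simp : ContinuousLinearMap.smulRight
      (0 : TangentSpace (𝓡 3) x →L[ℝ] ℝ) (f x) = 0), add_zero] at this
    exact DFunLike.congr_fun this (EuclideanSpace.single i (1 : ℝ) : EuclideanSpace ℝ (Fin 3))

theorem stdDifferential_mul (x : M) (f g : C^∞⟮𝓡 3, M; ℝ⟯) :
    stdDifferential x (f * g) = f x • stdDifferential x g + g x • stdDifferential x f := by
  ext i
  have := mvfderiv_mul (f.contMDiff.mdifferentiableAt (x := x) (by simp))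
      (g.contMDiff.mdifferentiableAt (x := x) (by simp))
  exact DFunLike.congr_fun this
    (EuclideanSpace.single i (1 : ℝ) : EuclideanSpace ℝ (Fin 3))

/-- The value of the Nambu bracket at a point. -/
noncomputable def ThreeForm.nambuAt (Ω : ThreeForm M) (x : M) :
    C^∞⟮𝓡 3, M; ℝ⟯ [⋀^Fin 3]→ₗ[ℝ] ℝ :=
  (Ω.stdCoeff x)⁻¹ • (Matrix.detRowAlternating (R := ℝ) (n := Fin 3)).compLinearMap
    (stdDifferential x)

theorem ThreeForm.nambuAt_apply (Ω : ThreeForm M) (x : M) (v : Fin 3 → C^∞⟮𝓡 3, M; ℝ⟯) :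
    Ω.nambuAt x v = (Ω.stdCoeff x)⁻¹ * ThreeForm.stdCoeff (M := M) (fun x => wedgeThree
      (mvfderiv (𝓡 3) (v 0) x) (mvfderiv (𝓡 3) (v 1) x) (mvfderiv (𝓡 3) (v 2) x)) x := by
  rw [nambuAt, AlternatingMap.smul_apply, smul_eq_mul]
  congr 1
  refine Eq.trans ?_ (wedgeThree_apply _ _ _ _).symm
  refine congrArg Matrix.det (?_ : (fun i => stdDifferential x (v i)) = _)
  ext i j
  fin_cases i <;> fin_cases j <;> rfl

theorem ThreeForm.IsVolumeForm.wedgeThree_eq {Ω : ThreeForm M} (hΩ : Ω.IsVolumeForm)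
    (f g h : C^∞⟮𝓡 3, M; ℝ⟯) (x : M) :
    wedgeThree (mvfderiv (𝓡 3) f x) (mvfderiv (𝓡 3) g x) (mvfderiv (𝓡 3) h x) =
      Ω.nambuAt x ![f, g, h] • Ω x := by
  have key : Ω.nambuAt x ![f, g, h] * Ω.stdCoeff x = ThreeForm.stdCoeff (M := M) (fun x =>
      wedgeThree (mvfderiv (𝓡 3) f x) (mvfderiv (𝓡 3) g x) (mvfderiv (𝓡 3) h x)) x := by
    rw [Ω.nambuAt_apply, mul_comm, mul_inv_cancel_left₀ (hΩ.stdCoeff_ne_zero x)]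
    rfl
  exact eq_smul_of_apply_single key.symm

variable [IsManifold (𝓡 3) ∞ M]

theorem contMDiffAt_extChartAt_symm_of_mem_target {c : M} {y : EuclideanSpace ℝ (Fin 3)}
    (hy : y ∈ (extChartAt (𝓡 3) c).target) :
    ContMDiffAt (𝓡 3) (𝓡 3) ∞ (extChartAt (𝓡 3) c).symm y :=
  (contMDiffOn_extChartAt_symm c).contMDiffAt ((isOpen_extChartAt_target c).mem_nhds hy)

theorem chartSymmDet_ne_zero {c : M} {y : EuclideanSpace ℝ (Fin 3)}
    (hy : y ∈ (extChartAt (𝓡 3) c).target) : chartSymmDet c y ≠ 0 := by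
  have h := isInvertible_mfderivWithin_extChartAt_symm (I := 𝓡 3) hy
  rw [modelWithCornersSelf_coe, range_id, mfderivWithin_univ] at h
  obtain ⟨e, he⟩ := h
  rw [chartSymmDet, ← he]
  exact (LinearEquiv.isUnit_det' (M := EuclideanSpace ℝ (Fin 3)) e.toLinearEquiv).ne_zero

theorem ThreeForm.IsVolumeForm.coeff_ne_zero {Ω : ThreeForm M} (hΩ : Ω.IsVolumeForm) {c : M}
    {y : EuclideanSpace ℝ (Fin 3)} (hy : y ∈ (extChartAt (𝓡 3) c).target) : Ω.coeff c y ≠ 0 := by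
  rw [Ω.coeff_eq]
  exact mul_ne_zero (chartSymmDet_ne_zero hy) (hΩ.stdCoeff_ne_zero _)

theorem ContMDiffMap.contDiffAt_comp_extChartAt_symm (f : C^∞⟮𝓡 3, M; ℝ⟯) {c : M}
    {y : EuclideanSpace ℝ (Fin 3)} (hy : y ∈ (extChartAt (𝓡 3) c).target) :
    ContDiffAt ℝ ∞ (fun z => f ((extChartAt (𝓡 3) c).symm z)) y :=
  (f.contMDiff.contMDiffAt.comp y (contMDiffAt_extChartAt_symm_of_mem_target hy)).contDiffAt

theorem ContMDiffMap.fderiv_comp_extChartAt_symm (f : C^∞⟮𝓡 3, M; ℝ⟯) {c : M}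
    {y : EuclideanSpace ℝ (Fin 3)} (hy : y ∈ (extChartAt (𝓡 3) c).target) :
    fderiv ℝ (fun z => f ((extChartAt (𝓡 3) c).symm z)) y =
      (mvfderiv (𝓡 3) f ((extChartAt (𝓡 3) c).symm y)).comp
        (mfderiv (𝓡 3) (𝓡 3) (extChartAt (𝓡 3) c).symm y) := by
  rw [← mfderiv_eq_fderiv]
  exact mvfderiv_comp y (f.contMDiff.mdifferentiableAt (by simp))
    ((contMDiffAt_extChartAt_symm_of_mem_target hy).mdifferentiableAt (by simp))

theorem jacobianThree_comp_extChartAt_symm (f g h : C^∞⟮𝓡 3, M; ℝ⟯) {c : M}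
    {y : EuclideanSpace ℝ (Fin 3)} (hy : y ∈ (extChartAt (𝓡 3) c).target) :
    jacobianThree (fun z => f ((extChartAt (𝓡 3) c).symm z))
      (fun z => g ((extChartAt (𝓡 3) c).symm z)) (fun z => h ((extChartAt (𝓡 3) c).symm z)) y =
      chartSymmDet c y * ThreeForm.stdCoeff (M := M) (fun x => wedgeThree (mvfderiv (𝓡 3) f x)
        (mvfderiv (𝓡 3) g x) (mvfderiv (𝓡 3) h x)) ((extChartAt (𝓡 3) c).symm y) := by
  rw [← ThreeForm.coeff_eq, jacobianThree, f.fderiv_comp_extChartAt_symm hy,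
    g.fderiv_comp_extChartAt_symm hy, h.fderiv_comp_extChartAt_symm hy]
  exact DFunLike.congr_fun (wedgeThree_comp (V := EuclideanSpace ℝ (Fin 3))
    (W := EuclideanSpace ℝ (Fin 3)) _ _ _ _) _

/-- The Jacobian and the coefficient of `Ω` carry the same factor `chartSymmDet c y`, which cancels.
The right side is visibly smooth, whereas `stdCoeff` refers to a basis that changes with the
preferred chart of each point. -/
theorem ThreeForm.nambuAt_extChartAt_symm (Ω : ThreeForm M)
    (f g h : C^∞⟮𝓡 3, M; ℝ⟯) {c : M} {y : EuclideanSpace ℝ (Fin 3)}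
    (hy : y ∈ (extChartAt (𝓡 3) c).target) :
    Ω.nambuAt ((extChartAt (𝓡 3) c).symm y) ![f, g, h] = (Ω.coeff c y)⁻¹ *
      jacobianThree (fun z => f ((extChartAt (𝓡 3) c).symm z))
        (fun z => g ((extChartAt (𝓡 3) c).symm z))
        (fun z => h ((extChartAt (𝓡 3) c).symm z)) y := by
  rw [jacobianThree_comp_extChartAt_symm f g h hy, Ω.nambuAt_apply, Ω.coeff_eq, mul_inv]
  have := chartSymmDet_ne_zero hy
  simp only [Matrix.cons_val]
  field_simp

theorem ThreeForm.IsVolumeForm.contMDiff_nambuAt {Ω : ThreeForm M} (hΩ : Ω.IsVolumeForm)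
    (v : Fin 3 → C^∞⟮𝓡 3, M; ℝ⟯) : ContMDiff (𝓡 3) 𝓘(ℝ) ∞ fun x => Ω.nambuAt x v := by
  intro c
  have hv : v = ![v 0, v 1, v 2] := by
    ext1 i
    fin_cases i <;> rfl
  have hy : extChartAt (𝓡 3) c c ∈ (extChartAt (𝓡 3) c).target := mem_extChartAt_target c
  have hs : ContDiffAt ℝ ∞ (fun y => (Ω.coeff c y)⁻¹ *
      jacobianThree (fun z => v 0 ((extChartAt (𝓡 3) c).symm z))
        (fun z => v 1 ((extChartAt (𝓡 3) c).symm z))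
        (fun z => v 2 ((extChartAt (𝓡 3) c).symm z)) y) (extChartAt (𝓡 3) c c) :=
    ((hΩ.smooth.contDiffAt_coeff hy).inv (hΩ.coeff_ne_zero hy)).mul
      (((v 0).contDiffAt_comp_extChartAt_symm hy).jacobianThree
        ((v 1).contDiffAt_comp_extChartAt_symm hy) ((v 2).contDiffAt_comp_extChartAt_symm hy))
  refine (hs.contMDiffAt.comp c (contMDiffAt_extChartAt (I := 𝓡 3) (x := c))).congr_of_eventuallyEq
    ?_
  filter_upwards [extChartAt_source_mem_nhds (I := 𝓡 3) c] with x hx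
  have h := Ω.nambuAt_extChartAt_symm (v 0) (v 1) (v 2) ((extChartAt (𝓡 3) c).map_source hx)
  rw [← hv, (extChartAt (𝓡 3) c).left_inv hx] at h
  exact h

/-- The Nambu bracket of a volume form, as an alternating map. -/
noncomputable def ThreeForm.IsVolumeForm.nambu {Ω : ThreeForm M} (hΩ : Ω.IsVolumeForm) :
    C^∞⟮𝓡 3, M; ℝ⟯ [⋀^Fin 3]→ₗ[ℝ] C^∞⟮𝓡 3, M; ℝ⟯ where
  toFun v := ⟨fun x => Ω.nambuAt x v, hΩ.contMDiff_nambuAt v⟩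
  map_update_add' v i f g := by
    ext x
    exact (Ω.nambuAt x).map_update_add v i f g
  map_update_smul' v i r f := by
    ext x
    exact (Ω.nambuAt x).map_update_smul v i r f
  map_eq_zero_of_eq' v i j h hij := by
    ext x
    exact (Ω.nambuAt x).map_eq_zero_of_eq v h hij

theorem ThreeForm.IsVolumeForm.nambu_apply {Ω : ThreeForm M} (hΩ : Ω.IsVolumeForm)
    (v : Fin 3 → C^∞⟮𝓡 3, M; ℝ⟯) (x : M) : hΩ.nambu v x = Ω.nambuAt x v := rfl

theorem ThreeForm.IsVolumeForm.isNambuBracket_nambu {Ω : ThreeForm M} (hΩ : Ω.IsVolumeForm) :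
    Ω.IsNambuBracket fun f g h => hΩ.nambu ![f, g, h] :=
  hΩ.wedgeThree_eq

theorem ThreeForm.IsVolumeForm.nambu_mul {Ω : ThreeForm M} (hΩ : Ω.IsVolumeForm)
    (f g h₁ h₂ : C^∞⟮𝓡 3, M; ℝ⟯) :
    hΩ.nambu ![f, g, h₁ * h₂] = hΩ.nambu ![f, g, h₁] * h₂ + h₁ * hΩ.nambu ![f, g, h₂] := by
  ext x
  -- Only the last row depends on `h`, so the product rule for the differential passes through the
  -- determinant.
  have key : ∀ h : C^∞⟮𝓡 3, M; ℝ⟯, hΩ.nambu ![f, g, h] x = (Ω.stdCoeff x)⁻¹ *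
      Matrix.det (Matrix.of ![stdDifferential x f, stdDifferential x g, stdDifferential x h]) := by
    intro h
    refine congrArg (fun A => (Ω.stdCoeff x)⁻¹ * Matrix.det A)
      (?_ : (fun i => stdDifferential x (![f, g, h] i)) = _)
    ext1 i
    fin_cases i <;> rfl
  rw [ContMDiffMap.coe_add, Pi.add_apply, ContMDiffMap.coe_mul, ContMDiffMap.coe_mul, Pi.mul_apply,
    Pi.mul_apply, key, key, key, stdDifferential_mul]
  simp only [Matrix.det_fin_three, Matrix.of_apply, Matrix.cons_val, Pi.add_apply, Pi.smul_apply, smul_eq_mul]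
  ring

theorem ThreeForm.IsVolumeForm.nambu_fundamental {Ω : ThreeForm M} (hΩ : Ω.IsVolumeForm)
    (f g h₁ h₂ h₃ : C^∞⟮𝓡 3, M; ℝ⟯) :
    hΩ.nambu ![f, g, hΩ.nambu ![h₁, h₂, h₃]] =
      hΩ.nambu ![hΩ.nambu ![f, g, h₁], h₂, h₃] + hΩ.nambu ![h₁, hΩ.nambu ![f, g, h₂], h₃]
      + hΩ.nambu ![h₁, h₂, hΩ.nambu ![f, g, h₃]] := by
  ext c
  have hy : extChartAt (𝓡 3) c c ∈ (extChartAt (𝓡 3) c).target := mem_extChartAt_target c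
  have hc : (extChartAt (𝓡 3) c).symm (extChartAt (𝓡 3) c c) = c := extChartAt_to_inv c
  -- An equality of germs is needed, since the outer bracket differentiates the inner one.
  have hbr : ∀ u v w : C^∞⟮𝓡 3, M; ℝ⟯,
      (fun z => hΩ.nambu ![u, v, w] ((extChartAt (𝓡 3) c).symm z))
      =ᶠ[nhds (extChartAt (𝓡 3) c c)] fun z => (Ω.coeff c z)⁻¹ *
      jacobianThree (fun z => u ((extChartAt (𝓡 3) c).symm z))
        (fun z => v ((extChartAt (𝓡 3) c).symm z))
        (fun z => w ((extChartAt (𝓡 3) c).symm z)) z := by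
    intro u v w
    filter_upwards [(isOpen_extChartAt_target c).mem_nhds hy] with z hz
    exact Ω.nambuAt_extChartAt_symm u v w hz
  have hat : ∀ u v w : C^∞⟮𝓡 3, M; ℝ⟯, hΩ.nambu ![u, v, w] c =
      (Ω.coeff c (extChartAt (𝓡 3) c c))⁻¹ *
      jacobianThree (fun z => u ((extChartAt (𝓡 3) c).symm z))
        (fun z => v ((extChartAt (𝓡 3) c).symm z))
        (fun z => w ((extChartAt (𝓡 3) c).symm z)) (extChartAt (𝓡 3) c c) := by
    intro u v w
    have := (hbr u v w).eq_of_nhds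
    beta_reduce at this
    rwa [hc] at this
  have hd := fun u : C^∞⟮𝓡 3, M; ℝ⟯ => u.contDiffAt_comp_extChartAt_symm hy
  have key := jacobianThree_fundamental (b := fun z => (Ω.coeff c z)⁻¹) (hd f) (hd g) (hd h₁) (hd h₂) (hd h₃)
    ((hΩ.smooth.contDiffAt_coeff hy).inv (hΩ.coeff_ne_zero hy))
  rw [ContMDiffMap.coe_add, Pi.add_apply, ContMDiffMap.coe_add, Pi.add_apply, hat, hat, hat, hat]
  simp only [jacobianThree, (hbr _ _ _).fderiv_eq]
  simp only [jacobianThree] at key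
  rw [key]
  ring

end Manifold

/-- The sign of a nonvanishing continuous function is locally constant, so it behaves like a
constant under derivatives. It need not be globally constant, because a chart target may be
disconnected; hence it is absorbed into `H`. -/
theorem jacobianThree_sign_mul {F G H a : EuclideanSpace ℝ (Fin 3) → ℝ}
    {y : EuclideanSpace ℝ (Fin 3)} (hH : ContDiffAt ℝ ∞ H y) (ha : ContinuousAt a y)
    (hy : a y ≠ 0) :
    ContDiffAt ℝ ∞ (fun z => (SignType.sign (a z) : ℝ) * H z) y ∧
      jacobianThree F G (fun z => (SignType.sign (a z) : ℝ) * H z) y =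
        SignType.sign (a y) * jacobianThree F G H y := by
  have hs : ∀ᶠ z in nhds y, SignType.sign (a z) = SignType.sign (a y) := by
    have := (continuousAt_sign_of_ne_zero hy).comp ha
    rwa [ContinuousAt, nhds_discrete SignType, Filter.tendsto_pure] at this
  have he : (fun z => (SignType.sign (a z) : ℝ) * H z) =ᶠ[nhds y]
      fun z => (SignType.sign (a y) : ℝ) * H z := by
    filter_upwards [hs] with z hz
    rw [hz]
  refine ⟨(contDiffAt_const.mul hH).congr_of_eventuallyEq he, ?_⟩
  have hp : ∀ i, partialDeriv i (fun z => (SignType.sign (a z) : ℝ) * H z) y =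
      SignType.sign (a y) * partialDeriv i H y := by
    intro i
    rw [partialDeriv_congr he, partialDeriv_mul contDiffAt_const hH]
    simp [partialDeriv]
  rw [jacobianThree_eq, jacobianThree_eq, hp, hp, hp]
  ring

/-! ### Integration against `|Ω|` in one chart and change of charts. -/

section Manifold

variable {M : Type*} [TopologicalSpace M] [ChartedSpace (EuclideanSpace ℝ (Fin 3)) M]

/-- The integral `∫ w |a| dy` over the preferred chart at `c`, where `a` is the coefficient of
`Ω` in this chart. -/
noncomputable def ThreeForm.chartIntegral (Ω : ThreeForm M) (c : M) (w : M → ℝ) : ℝ :=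
  ∫ y in (extChartAt (𝓡 3) c).target, w ((extChartAt (𝓡 3) c).symm y) * |Ω.coeff c y|

theorem ThreeForm.coeff_smul (η : ThreeForm M) (u : M → ℝ) (c : M)
    (y : EuclideanSpace ℝ (Fin 3)) :
    ThreeForm.coeff (fun x => u x • η x) c y =
      u ((extChartAt (𝓡 3) c).symm y) * η.coeff c y := rfl

theorem isCompact_extChartAt_image_tsupport
    {c : M} {w : M → ℝ} (hc : HasCompactSupport w)
    (hwc : tsupport w ⊆ (extChartAt (𝓡 3) c).source) :
    IsCompact (extChartAt (𝓡 3) c '' tsupport w) ∧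
      extChartAt (𝓡 3) c '' tsupport w ⊆ (extChartAt (𝓡 3) c).target ∧
      ∀ y ∈ (extChartAt (𝓡 3) c).target, y ∉ extChartAt (𝓡 3) c '' tsupport w →
        w ((extChartAt (𝓡 3) c).symm y) = 0 := by
  refine ⟨hc.isCompact.image_of_continuousOn ((continuousOn_extChartAt c).mono hwc), ?_, ?_⟩
  · rintro _ ⟨x, hx, rfl⟩
    exact (extChartAt (𝓡 3) c).map_source (hwc hx)
  · intro y hy hyK
    refine image_eq_zero_of_notMem_tsupport fun h => hyK ⟨_, h, ?_⟩
    exact (extChartAt (𝓡 3) c).right_inv hy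

theorem ThreeForm.IsSmooth.continuous_indicator_chart {Ω : ThreeForm M} (hΩ : Ω.IsSmooth)
    {c : M} {w : M → ℝ} (hw : Continuous w) (hc : HasCompactSupport w)
    (hwc : tsupport w ⊆ (extChartAt (𝓡 3) c).source) :
    Continuous ((extChartAt (𝓡 3) c).target.indicator
      fun y => w ((extChartAt (𝓡 3) c).symm y) * |Ω.coeff c y|) ∧
    HasCompactSupport ((extChartAt (𝓡 3) c).target.indicator
      fun y => w ((extChartAt (𝓡 3) c).symm y) * |Ω.coeff c y|) := by
  obtain ⟨hK, hKU, hK0⟩ := isCompact_extChartAt_image_tsupport hc hwc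
  have h0 : ∀ y ∉ extChartAt (𝓡 3) c '' tsupport w, (extChartAt (𝓡 3) c).target.indicator
      (fun y => w ((extChartAt (𝓡 3) c).symm y) * |Ω.coeff c y|) y = 0 := by
    intro y hy
    by_cases hyU : y ∈ (extChartAt (𝓡 3) c).target
    · rw [indicator_of_mem hyU, hK0 y hyU hy, zero_mul]
    · exact indicator_of_notMem hyU _
  refine ⟨continuous_iff_continuousAt.2 fun y => ?_, HasCompactSupport.intro hK h0⟩
  by_cases hy : y ∈ (extChartAt (𝓡 3) c).target
  · have h1 : ContinuousAt (fun y => w ((extChartAt (𝓡 3) c).symm y) * |Ω.coeff c y|) y :=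
      (hw.continuousAt.comp (continuousAt_extChartAt_symm'' hy)).mul
        (hΩ.contDiffAt_coeff hy).continuousAt.abs
    refine h1.congr ?_
    filter_upwards [(isOpen_extChartAt_target c).mem_nhds hy] with z hz
    exact (indicator_of_mem hz (fun y => w ((extChartAt (𝓡 3) c).symm y) * |Ω.coeff c y|)).symm
  · refine (continuousAt_const (y := (0 : ℝ))).congr ?_
    filter_upwards [hK.isClosed.isOpen_compl.mem_nhds fun h => hy (hKU h)] with z hz
    exact (h0 z hz).symm

theorem ThreeForm.IsSmooth.integrableOn_chart {Ω : ThreeForm M} (hΩ : Ω.IsSmooth)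
    {c : M} {w : M → ℝ} (hw : Continuous w) (hc : HasCompactSupport w)
    (hwc : tsupport w ⊆ (extChartAt (𝓡 3) c).source) :
    IntegrableOn (fun y => w ((extChartAt (𝓡 3) c).symm y) * |Ω.coeff c y|)
      (extChartAt (𝓡 3) c).target := by
  obtain ⟨h1, h2⟩ := hΩ.continuous_indicator_chart hw hc hwc
  rw [← integrable_indicator_iff (isOpen_extChartAt_target c).measurableSet]
  exact h1.integrable_of_hasCompactSupport h2

theorem ThreeForm.IsSmooth.chartIntegral_sum {Ω : ThreeForm M} (hΩ : Ω.IsSmooth) {c : M}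
    {ι : Type*} (s : Finset ι) {w : ι → M → ℝ} (hw : ∀ i ∈ s, Continuous (w i))
    (hc : ∀ i ∈ s, HasCompactSupport (w i))
    (hwc : ∀ i ∈ s, tsupport (w i) ⊆ (extChartAt (𝓡 3) c).source) :
    Ω.chartIntegral c (fun x => ∑ i ∈ s, w i x) = ∑ i ∈ s, Ω.chartIntegral c (w i) := by
  simp only [ThreeForm.chartIntegral, Finset.sum_mul]
  exact integral_finsetSum s fun i hi => hΩ.integrableOn_chart (hw i hi) (hc i hi) (hwc i hi)

theorem ThreeForm.chartIntegral_nonneg (Ω : ThreeForm M) {c : M} {w : M → ℝ}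
    (h0 : ∀ x, 0 ≤ w x) : 0 ≤ Ω.chartIntegral c w :=
  integral_nonneg fun _ => mul_nonneg (h0 _) (abs_nonneg _)

theorem stdDifferential_eq_zero {h : C^∞⟮𝓡 3, M; ℝ⟯} {x : M} (hx : x ∉ tsupport h) :
    stdDifferential x h = 0 := by
  have he : (h : M → ℝ) =ᶠ[nhds x] fun _ => 0 := notMem_tsupport_iff_eventuallyEq.1 hx
  ext i
  have : mvfderiv (𝓡 3) h x = 0 := by
    rw [mvfderiv, he.mfderiv_eq, mfderiv_const]
    exact ContinuousLinearMap.comp_zero _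
  exact DFunLike.congr_fun this
    (EuclideanSpace.single i (1 : ℝ) : EuclideanSpace ℝ (Fin 3))

variable [IsManifold (𝓡 3) ∞ M]

theorem ThreeForm.IsVolumeForm.chartIntegral_pos {Ω : ThreeForm M}
    (hΩ : Ω.IsVolumeForm) {c : M} {w : M → ℝ} (hw : Continuous w) (hc : HasCompactSupport w)
    (hwc : tsupport w ⊆ (extChartAt (𝓡 3) c).source) (h0 : ∀ x, 0 ≤ w x) {x : M} (hx : w x ≠ 0) : 0 < Ω.chartIntegral c w := by
  obtain ⟨h1, h2⟩ := hΩ.smooth.continuous_indicator_chart hw hc hwc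
  have hxc : x ∈ (extChartAt (𝓡 3) c).source := hwc (subset_tsupport _ hx)
  have hy := (extChartAt (𝓡 3) c).map_source hxc
  rw [ThreeForm.chartIntegral, ← integral_indicator (isOpen_extChartAt_target c).measurableSet]
  refine h1.integral_pos_of_hasCompactSupport_nonneg_nonzero h2
    (fun y => indicator_nonneg (fun z _ => mul_nonneg (h0 _) (abs_nonneg _)) y)
    (x := extChartAt (𝓡 3) c x) ?_
  rw [indicator_of_mem hy, (extChartAt (𝓡 3) c).left_inv hxc]
  exact mul_ne_zero hx (abs_ne_zero.2 (hΩ.coeff_ne_zero hy))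

/-- Near `y` the inverse chart at `c` is the inverse chart at `d` after the transition map; take
determinants in the chain rule. -/
theorem ThreeForm.coeff_chart_change (Ω : ThreeForm M) {c d : M}
    {y : EuclideanSpace ℝ (Fin 3)} (hy : y ∈ (extChartAt (𝓡 3) c).target)
    (hyd : (extChartAt (𝓡 3) c).symm y ∈ (extChartAt (𝓡 3) d).source) :
    DifferentiableAt ℝ (fun z => extChartAt (𝓡 3) d ((extChartAt (𝓡 3) c).symm z)) y ∧
    Ω.coeff c y =
      (fderiv ℝ (fun z => extChartAt (𝓡 3) d ((extChartAt (𝓡 3) c).symm z)) y).det *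
        Ω.coeff d (extChartAt (𝓡 3) d ((extChartAt (𝓡 3) c).symm y)) := by
  have hsymm := contMDiffAt_extChartAt_symm_of_mem_target hy
  have hτ : ContMDiffAt (𝓡 3) (𝓡 3) ∞
      (fun z => extChartAt (𝓡 3) d ((extChartAt (𝓡 3) c).symm z)) y :=
    (contMDiffAt_extChartAt' (by rwa [extChartAt_source] at hyd)).comp y hsymm
  refine ⟨hτ.contDiffAt.differentiableAt (by simp), ?_⟩
  have hty := (extChartAt (𝓡 3) d).map_source hyd
  have hloc : (extChartAt (𝓡 3) c).symm =ᶠ[nhds y] (extChartAt (𝓡 3) d).symm ∘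
      fun z => extChartAt (𝓡 3) d ((extChartAt (𝓡 3) c).symm z) := by
    filter_upwards [hsymm.continuousAt.preimage_mem_nhds
      ((isOpen_extChartAt_source d).mem_nhds hyd)] with z hz
    exact ((extChartAt (𝓡 3) d).left_inv hz).symm
  have hdet : chartSymmDet c y =
      (fderiv ℝ (fun z => extChartAt (𝓡 3) d ((extChartAt (𝓡 3) c).symm z)) y).det *
        chartSymmDet d (extChartAt (𝓡 3) d ((extChartAt (𝓡 3) c).symm y)) := by
    rw [chartSymmDet, chartSymmDet, hloc.mfderiv_eq, mfderiv_comp y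
      ((contMDiffAt_extChartAt_symm_of_mem_target hty).mdifferentiableAt (by simp))
      (hτ.mdifferentiableAt (by simp)), mfderiv_eq_fderiv, mul_comm]
    exact LinearMap.det_comp (M := EuclideanSpace ℝ (Fin 3)) _ _
  rw [Ω.coeff_eq, Ω.coeff_eq, (extChartAt (𝓡 3) d).left_inv hyd, hdet, mul_assoc]

/-- The integral of a function against `|Ω|` does not depend on the chart. -/
theorem ThreeForm.chartIntegral_eq (Ω : ThreeForm M) {c d : M} {w : M → ℝ}
    (hwc : support w ⊆ (extChartAt (𝓡 3) c).source)
    (hwd : support w ⊆ (extChartAt (𝓡 3) d).source) :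
    Ω.chartIntegral c w = Ω.chartIntegral d w := by
  -- The overlap of the two charts, seen in the first; `w` vanishes off it.
  set V : M → M → Set (EuclideanSpace ℝ (Fin 3)) := fun c d =>
    (extChartAt (𝓡 3) c).target ∩ (extChartAt (𝓡 3) c).symm ⁻¹' (extChartAt (𝓡 3) d).source
    with hV
  have hVint : ∀ c d : M, support w ⊆ (extChartAt (𝓡 3) d).source → Ω.chartIntegral c w =
      ∫ y in V c d, w ((extChartAt (𝓡 3) c).symm y) * |Ω.coeff c y| := by
    intro c d hwd
    refine setIntegral_eq_of_subset_of_forall_sdiff_eq_zero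
      (isOpen_extChartAt_target c).measurableSet inter_subset_left fun y hy => ?_
    rw [notMem_support.1 fun h => hy.2 ⟨hy.1, hwd h⟩, zero_mul]
  have hVm : MeasurableSet (V c d) :=
    ((continuousOn_extChartAt_symm c).isOpen_inter_preimage (isOpen_extChartAt_target c)
      (isOpen_extChartAt_source d)).measurableSet
  have himg : V d c =
      (fun z => extChartAt (𝓡 3) d ((extChartAt (𝓡 3) c).symm z)) '' V c d := by
    ext z
    constructor
    · rintro ⟨hz, hzc⟩
      refine ⟨extChartAt (𝓡 3) c ((extChartAt (𝓡 3) d).symm z),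
        ⟨(extChartAt (𝓡 3) c).map_source hzc, ?_⟩, ?_⟩
      · rw [mem_preimage, (extChartAt (𝓡 3) c).left_inv hzc]
        exact (extChartAt (𝓡 3) d).map_target hz
      · beta_reduce
        rw [(extChartAt (𝓡 3) c).left_inv hzc, (extChartAt (𝓡 3) d).right_inv hz]
    · rintro ⟨y, ⟨hy, hyd⟩, rfl⟩
      refine ⟨(extChartAt (𝓡 3) d).map_source hyd, ?_⟩
      rw [mem_preimage, (extChartAt (𝓡 3) d).left_inv hyd]
      exact (extChartAt (𝓡 3) c).map_target hy
  have hinj : InjOn (fun z => extChartAt (𝓡 3) d ((extChartAt (𝓡 3) c).symm z)) (V c d) := by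
    intro y hy z hz h
    exact (extChartAt (𝓡 3) c).symm.injOn hy.1 hz.1 ((extChartAt (𝓡 3) d).injOn hy.2 hz.2 h)
  -- The absolute Jacobian from the change of variables is exactly the factor relating the two
  -- values of `|Ω.coeff|`.
  rw [hVint c d hwd, hVint d c hwc, himg,
    integral_image_eq_integral_abs_det_fderiv_smul volume hVm
      (fun y hy => (Ω.coeff_chart_change hy.1 hy.2).1.hasFDerivAt.hasFDerivWithinAt) hinj]
  refine setIntegral_congr_fun hVm fun y hy => ?_
  simp only [(extChartAt (𝓡 3) d).left_inv hy.2, (Ω.coeff_chart_change hy.1 hy.2).2, abs_mul,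
    smul_eq_mul]
  ring

/-- The bracket sees `h` only through `dh`, which vanishes off the support of `h`. -/
theorem ThreeForm.IsVolumeForm.tsupport_nambu_subset {Ω : ThreeForm M} (hΩ : Ω.IsVolumeForm)
    (f g h : C^∞⟮𝓡 3, M; ℝ⟯) : tsupport (hΩ.nambu ![f, g, h]) ⊆ tsupport h := by
  refine closure_minimal (fun x hx => ?_) (isClosed_tsupport _)
  by_contra hxh
  refine hx (?_ : (Ω.stdCoeff x)⁻¹ * _ = 0)
  have := (Matrix.detRowAlternating (R := ℝ) (n := Fin 3)).map_coord_zero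
    (m := fun i => stdDifferential x (![f, g, h] i)) 2 (stdDifferential_eq_zero hxh)
  exact mul_eq_zero_of_right _ this

/-- The bracket with a function supported in a chart domain has integral zero. -/
theorem ThreeForm.IsVolumeForm.chartIntegral_nambu {Ω : ThreeForm M} (hΩ : Ω.IsVolumeForm)
    (f g h : C^∞⟮𝓡 3, M; ℝ⟯) {c : M} (hc : HasCompactSupport h)
    (hh : tsupport h ⊆ (extChartAt (𝓡 3) c).source) :
    Ω.chartIntegral c (hΩ.nambu ![f, g, h]) = 0 := by
  obtain ⟨hK, hKU, hK0⟩ := isCompact_extChartAt_image_tsupport hc hh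
  have hU := isOpen_extChartAt_target (I := 𝓡 3) c
  have hsign := fun y (hy : y ∈ (extChartAt (𝓡 3) c).target) =>
    jacobianThree_sign_mul (F := fun z => f ((extChartAt (𝓡 3) c).symm z))
      (G := fun z => g ((extChartAt (𝓡 3) c).symm z))
      (h.contDiffAt_comp_extChartAt_symm hy) (hΩ.smooth.contDiffAt_coeff hy).continuousAt
      (hΩ.coeff_ne_zero hy)
  have hz := setIntegral_jacobianThree_eq_zero hU hK hKU
    (fun y hy => f.contDiffAt_comp_extChartAt_symm hy)
    (fun y hy => g.contDiffAt_comp_extChartAt_symm hy) (fun y hy => (hsign y hy).1)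
    (fun y hy hyK => by rw [hK0 y hy hyK, mul_zero])
  rw [← hz, ThreeForm.chartIntegral]
  refine setIntegral_congr_fun hU.measurableSet fun y hy => ?_
  have h1 := Ω.nambuAt_extChartAt_symm f g h hy
  simp only [hΩ.nambu_apply, h1, (hsign y hy).2]
  rw [← sign_mul_self (Ω.coeff c y)]
  have := hΩ.coeff_ne_zero hy
  field_simp

/-! ### The global integral, positivity and metricity. -/

section Compact

variable [T2Space M] [CompactSpace M]

theorem tsupport_chartPartition_subset (c : M) :
    tsupport (chartPartition M c) ⊆ (extChartAt (𝓡 3) c).source := by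
  rw [extChartAt_source]
  exact (SmoothPartitionOfUnity.exists_isSubordinate_chartAt_source (𝓡 3) M).choose_spec c

variable (M) in
theorem finite_chartPartition : {c : M | (support (chartPartition M c)).Nonempty}.Finite :=
  (chartPartition M).locallyFinite.finite_nonempty_of_compact

variable (M) in
/-- The finitely many charts that contribute to integrals. -/
noncomputable def chartIndex : Finset M := (finite_chartPartition M).toFinset

theorem chartPartition_apply_eq_zero {c : M} (hc : c ∉ chartIndex M) (x : M) :
    chartPartition M c x = 0 := by
  by_contra h
  exact hc ((finite_chartPartition M).mem_toFinset.2 ⟨x, h⟩)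

theorem sum_chartPartition (x : M) : ∑ c ∈ chartIndex M, chartPartition M c x = 1 := by
  rw [← (chartPartition M).sum_eq_one (mem_univ x)]
  refine (finsum_eq_sum_of_support_subset _ fun c hc => ?_).symm
  by_contra h
  exact hc (chartPartition_apply_eq_zero h x)

theorem tsupport_chartPartition_mul_subset (c : M) (u : M → ℝ) :
    tsupport (fun x => chartPartition M c x * u x) ⊆ (extChartAt (𝓡 3) c).source :=
  (closure_mono (support_mul_subset_left _ _)).trans (tsupport_chartPartition_subset c)

/-- The integral of a function against the volume form is a finite sum over charts. -/
theorem ThreeForm.integral_smul_eq (Ω : ThreeForm M) (u : M → ℝ) :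
    Ω.integral (fun x => u x • Ω x) =
      ∑ c ∈ chartIndex M, Ω.chartIntegral c fun x => chartPartition M c x * u x := by
  have h : ∀ c : M, (∫ y in (extChartAt (𝓡 3) c).target, Ω.chartSign c y *
      (chartPartition M c ((extChartAt (𝓡 3) c).symm y) *
        ThreeForm.coeff (fun x => u x • Ω x) c y)) =
      Ω.chartIntegral c fun x => chartPartition M c x * u x := by
    intro c
    refine integral_congr_ae (Filter.Eventually.of_forall fun y => ?_)
    simp only [Ω.coeff_smul, ThreeForm.chartSign]
    -- The orientation sign times the coefficient of `Ω` is its absolute value.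
    rw [← sign_mul_self (Ω.coeff c y)]
    ring
  rw [ThreeForm.integral]
  simp only [h]
  refine finsum_eq_sum_of_support_subset _ fun c hc => ?_
  by_contra hcI
  refine hc ?_
  simp only [ThreeForm.chartIntegral, chartPartition_apply_eq_zero hcI, zero_mul, integral_zero]

/-- Integration against a volume form, as a linear functional on smooth functions. -/
noncomputable def ThreeForm.IsVolumeForm.integralLinear {Ω : ThreeForm M} (hΩ : Ω.IsVolumeForm) :
    C^∞⟮𝓡 3, M; ℝ⟯ →ₗ[ℝ] ℝ where
  toFun u := Ω.integral fun x => u x • Ω x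
  map_add' u v := by
    rw [Ω.integral_smul_eq, Ω.integral_smul_eq, Ω.integral_smul_eq, ← Finset.sum_add_distrib]
    refine Finset.sum_congr rfl fun c _ => ?_
    have h := fun u : C^∞⟮𝓡 3, M; ℝ⟯ =>
      hΩ.smooth.integrableOn_chart (c := c)
        ((chartPartition M c).contMDiff.continuous.mul u.contMDiff.continuous)
        (HasCompactSupport.of_compactSpace _) (tsupport_chartPartition_mul_subset c u)
    refine Eq.trans ?_ (integral_add (h u) (h v))
    refine integral_congr_ae (Filter.Eventually.of_forall fun y => ?_)
    simp only [ContMDiffMap.coe_add, Pi.add_apply]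
    ring
  map_smul' r u := by
    rw [Ω.integral_smul_eq, Ω.integral_smul_eq, smul_eq_mul, Finset.mul_sum]
    refine Finset.sum_congr rfl fun c _ => ?_
    refine Eq.trans ?_ (integral_const_mul _ _)
    refine integral_congr_ae (Filter.Eventually.of_forall fun y => ?_)
    simp only [ContMDiffMap.coe_smul, Pi.smul_apply, smul_eq_mul, RingHom.id_apply]
    ring

theorem ThreeForm.IsVolumeForm.integralLinear_apply {Ω : ThreeForm M} (hΩ : Ω.IsVolumeForm)
    (u : C^∞⟮𝓡 3, M; ℝ⟯) : hΩ.integralLinear u =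
      ∑ c ∈ chartIndex M, Ω.chartIntegral c fun x => chartPartition M c x * u x :=
  Ω.integral_smul_eq u

theorem ThreeForm.IsVolumeForm.pairing_eq {Ω : ThreeForm M} (hΩ : Ω.IsVolumeForm)
    (f g : C^∞⟮𝓡 3, M; ℝ⟯) : Ω.pairing f g = hΩ.integralLinear (f * g) := rfl

theorem ThreeForm.IsVolumeForm.pairing_self_pos {Ω : ThreeForm M} (hΩ : Ω.IsVolumeForm)
    {f : C^∞⟮𝓡 3, M; ℝ⟯} (hf : f ≠ 0) : 0 < Ω.pairing f f := by
  obtain ⟨x, hx⟩ : ∃ x, f x ≠ 0 := by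
    by_contra! h
    exact hf (ContMDiffMap.ext h)
  obtain ⟨c, hc⟩ := (chartPartition M).exists_pos_of_mem (mem_univ x)
  have h0 : ∀ c z, 0 ≤ chartPartition M c z * (f * f) z := fun c z =>
    mul_nonneg ((chartPartition M).nonneg c z) (mul_self_nonneg (f z))
  rw [hΩ.pairing_eq, hΩ.integralLinear_apply]
  refine Finset.sum_pos' (fun d _ => Ω.chartIntegral_nonneg (h0 d)) ⟨c, ?_, ?_⟩
  · by_contra h
    exact hc.ne' (chartPartition_apply_eq_zero h x)
  · exact hΩ.chartIntegral_pos
      ((chartPartition M c).contMDiff.continuous.mul (f * f).contMDiff.continuous)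
      (HasCompactSupport.of_compactSpace _) (tsupport_chartPartition_mul_subset c _) (h0 c)
      (mul_ne_zero hc.ne' (mul_self_ne_zero.2 hx) : chartPartition M c x * (f * f) x ≠ 0)

/-- If `v` is supported in a chart domain, its integral can be computed in this chart. -/
theorem ThreeForm.IsVolumeForm.integralLinear_eq_chartIntegral {Ω : ThreeForm M}
    (hΩ : Ω.IsVolumeForm) {v : C^∞⟮𝓡 3, M; ℝ⟯} {d : M}
    (hv : tsupport v ⊆ (extChartAt (𝓡 3) d).source) :
    hΩ.integralLinear v = Ω.chartIntegral d v := by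
  have hsub : ∀ c, tsupport (fun x => chartPartition M c x * v x) ⊆
      (extChartAt (𝓡 3) d).source := fun c =>
    (closure_mono (support_mul_subset_right _ _)).trans hv
  have hsum : (v : M → ℝ) = fun x => ∑ c ∈ chartIndex M, chartPartition M c x * v x := by
    ext x
    rw [← Finset.sum_mul, sum_chartPartition, one_mul]
  have h := hΩ.smooth.chartIntegral_sum (c := d) (chartIndex M)
    (w := fun c x => chartPartition M c x * v x)
    (fun c _ => (chartPartition M c).contMDiff.continuous.mul v.contMDiff.continuous)
    (fun c _ => HasCompactSupport.of_compactSpace _) (fun c _ => hsub c)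
  rw [← hsum] at h
  rw [hΩ.integralLinear_apply, h]
  refine Finset.sum_congr rfl fun c _ => ?_
  -- Each piece is supported in both chart domains, so its integral may be moved from the chart at
  -- `c` to the one at `d`.
  exact Ω.chartIntegral_eq
    ((subset_tsupport _).trans (tsupport_chartPartition_mul_subset c v))
    ((subset_tsupport _).trans (hsub c))

theorem ThreeForm.IsVolumeForm.integralLinear_nambu {Ω : ThreeForm M} (hΩ : Ω.IsVolumeForm)
    (f g h : C^∞⟮𝓡 3, M; ℝ⟯) : hΩ.integralLinear (hΩ.nambu ![f, g, h]) = 0 := by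
  have hupd : ∀ u, update ![f, g, 0] 2 u = ![f, g, u] := by
    intro u
    ext1 i
    fin_cases i <;> rfl
  have hlin : ∀ u, hΩ.nambu.toMultilinearMap.toLinearMap ![f, g, 0] 2 u =
      hΩ.nambu ![f, g, u] := fun u => congrArg hΩ.nambu (hupd u)
  have hh : h = ∑ d ∈ chartIndex M, chartPartition M d * h := by
    rw [← Finset.sum_mul]
    have : ∑ d ∈ chartIndex M, chartPartition M d = 1 := by
      ext x
      have := map_sum (ContMDiffMap.coeFnLinearMap (𝕜 := ℝ) (I := 𝓡 3) (N := M) (n := ∞) (V := ℝ))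
        (fun d => chartPartition M d) (chartIndex M)
      refine (congrFun this x).trans ?_
      rw [Finset.sum_apply]
      exact sum_chartPartition x
    rw [this, one_mul]
  rw [← hlin, hh, map_sum, map_sum]
  refine Finset.sum_eq_zero fun d _ => ?_
  have hd : tsupport (chartPartition M d * h) ⊆ (extChartAt (𝓡 3) d).source :=
    tsupport_chartPartition_mul_subset d h
  rw [hlin, hΩ.integralLinear_eq_chartIntegral ((hΩ.tsupport_nambu_subset _ _ _).trans hd)]
  exact hΩ.chartIntegral_nambu f g _ (HasCompactSupport.of_compactSpace _) hd

theorem ThreeForm.IsVolumeForm.metricity {Ω : ThreeForm M} (hΩ : Ω.IsVolumeForm)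
    (f g h₁ h₂ : C^∞⟮𝓡 3, M; ℝ⟯) :
    Ω.pairing (hΩ.nambu ![f, g, h₁]) h₂ = -Ω.pairing (hΩ.nambu ![f, g, h₂]) h₁ := by
  -- By Leibniz the two integrands add up to the single bracket `{f, g, h₁ h₂}`.
  rw [eq_neg_iff_add_eq_zero, hΩ.pairing_eq, hΩ.pairing_eq, ← map_add,
    mul_comm (hΩ.nambu ![f, g, h₂]), ← hΩ.nambu_mul]
  exact hΩ.integralLinear_nambu f g _

theorem ThreeForm.IsVolumeForm.isMetricThreeLieAlgebra {Ω : ThreeForm M} (hΩ : Ω.IsVolumeForm) :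
    IsMetricThreeLieAlgebra (fun f g h => hΩ.nambu ![f, g, h]) Ω.pairing where
  alternating := ⟨hΩ.nambu, fun _ _ _ => rfl⟩
  bilinear := ⟨(LinearMap.mul ℝ C^∞⟮𝓡 3, M; ℝ⟯).compr₂ hΩ.integralLinear, fun _ _ => rfl⟩
  symmetric f g := by rw [hΩ.pairing_eq, hΩ.pairing_eq, mul_comm]
  nondegenerate f hf := by
    by_contra h
    exact (hΩ.pairing_self_pos h).ne' (hf f)
  metricity := hΩ.metricity
  fundamental := hΩ.nambu_fundamental

end Compact

end Manifold

theorem mainTheorem7 {M : Type*} [TopologicalSpace M] [T2Space M] [CompactSpace M]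
    [ChartedSpace (EuclideanSpace ℝ (Fin 3)) M] [IsManifold (𝓡 3) ∞ M]
    (Ω : ThreeForm M) (hΩ : Ω.IsVolumeForm) :
    ∃ br : C^∞⟮𝓡 3, M; ℝ⟯ → C^∞⟮𝓡 3, M; ℝ⟯ → C^∞⟮𝓡 3, M; ℝ⟯ → C^∞⟮𝓡 3, M; ℝ⟯,
      Ω.IsNambuBracket br ∧
      (∀ br', Ω.IsNambuBracket br' → br' = br) ∧
      (∀ f g h₁ h₂, br f g (h₁ * h₂) = br f g h₁ * h₂ + h₁ * br f g h₂) ∧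
      IsMetricThreeLieAlgebra br Ω.pairing ∧
      (∀ f, f ≠ 0 → 0 < Ω.pairing f f) := by
  refine ⟨fun f g h => hΩ.nambu ![f, g, h], hΩ.isNambuBracket_nambu, fun br' hbr => ?_,
    hΩ.nambu_mul, hΩ.isMetricThreeLieAlgebra, fun f hf => hΩ.pairing_self_pos hf⟩
  funext f g h
  ext x
  exact hΩ.smul_left_injective x ((hbr f g h x).symm.trans (hΩ.isNambuBracket_nambu f g h x))
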